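/- **Setting.** Let $A$ be a set of actions, with $\delta,\epsilon\notin A$, write $A_\delta=A\cup\{\delta\}$ and $A_\epsilon=A\cup\{\epsilon\}$, and let $\gamma:A_\delta\times A_\delta\to A_\delta$ be a commutative and associative function with $\gamma(\delta,a)=\delta$ for all $a\in A_\delta$. Terms are built from the variables of a fixed countably infinite set. "Derivable" means derivable in equational logic (reflexivity, symmetry, transitivity, congruence, substitution). **ACP$_\epsilon$** has the constants $\delta$, $\epsilon$ and $a$ ($a\in A$), the binary operators $+$, $\cdot$, $\parallel$, $\mathbin{\lfloor\!\lfloor}$ (left merge), $\mid$ (communication merge), and the unary operators $\partial_H$ ($H\subseteq A$). Its axioms are, for all $a,b\in A_\delta$ and $H\subseteq A$: $x+y=y+x$; $(x+y)+z=x+(y+z)$; $x+x=x$; $(x+y)z=xz+yz$; $(xy)z=x(yz)$; $x+\delta=x$; $\delta x=\delta$; $x\epsilon=x$; $\epsilon x=x$; $\partial_H(\epsilon)=\epsilon$; $\partial_H(a)=a$ if $a\notin H$; $\partial_H(a)=\delta$ if $a\in H$; $\partial_H(x+y)=\partial_H(x)+\partial_H(y)$; $\partial_H(xy)=\partial_H(x)\partial_H(y)$;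 $x\parallel y=x\mathbin{\lfloor\!\lfloor}y+y\mathbin{\lfloor\!\lfloor}x+x\mid y+\partial_A(x)\partial_A(y)$; $\epsilon\mathbin{\lfloor\!\lfloor}x=\delta$; $ax\mathbin{\lfloor\!\lfloor}y=a(x\parallel y)$; $(x+y)\mathbin{\lfloor\!\lfloor}z=x\mathbin{\lfloor\!\lfloor}z+y\mathbin{\lfloor\!\lfloor}z$; $\epsilon\mid x=\delta$; $x\mid\epsilon=\delta$; $ax\mid by=\gamma(a,b)(x\parallel y)$; $(x+y)\mid z=x\mid z+y\mid z$; $x\mid(y+z)=x\mid y+x\mid z$; $a\mid b=\gamma(a,b)$; $\delta\mid x=\delta$; $x\mid\delta=\delta$. **Histories.** Let $\mathbb N_1$ be the set of positive integers. The set $\mathcal H_0$ of interleaving histories is the least set of finite sequences over $\mathbb N_1\times\mathbb N_1$ that contains the empty sequence, contains $(i,n)$ whenever $i\le n$, and contains $h(i,n)(j,m)$ whenever it contains $h(i,n)$ and $j\le n$, $n-1\le m\le n+1$. Let $\mathcal H\supseteq\mathcal H_0$ be a set of finite sequences over $\mathbb N_1\times\mathbb N_1$ (in particular, $\mathcal H=\mathcal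 H_0$ is allowed). **Strategy.** Let there be given: a set $S$ (control states); for each $n\ge1$ a partial function $\sigma_n:\mathcal H\times S\rightharpoonup\{1,\dots,n\}$ and a total function $\vartheta_n:\mathcal H\times S\times\{1,\dots,n\}\times A_\epsilon\to S$; a set $C\subseteq A$ with an action $\bar c\in A\setminus C$ for each $c\in C$; a countable set $D$; for each $d\in D$ two actions $\mathrm{cr}(d),\overline{\mathrm{cr}}(d)\in A\setminus(C\cup\{\bar c: c\in C\})$, where $\mathrm{cr}(d)\ne\mathrm{cr}(d')$ if $d\ne d'$; such that for every $e$ of the form $c$, $\bar c$, $\mathrm{cr}(d)$ or $\overline{\mathrm{cr}}(d)$ ($c\in C$, $d\in D$) and all $a,b\in A$, $\gamma(a,b)\ne e$ and $\gamma(a,e)=\delta$. Finally, for each $d\in D$, let a closed siACP$_\epsilon$ term $\Phi(d)$ be given. **siACP$_\epsilon$** extends the signature of ACP$_\epsilon$ with $n$-ary operators $\|^n_{h,s}$ and $\lfloor\!\lfloor^{n,i}_{h,s}$ ($n\ge1$, $1\le i\le n$, $h\in\mathcal H$, $s\in S$). Write $f(\vec x[i:=t])$ for $f(x_1,\dots,x_{i-1},t,x_{i+1},\dots,x_n)$.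 The axioms are those of ACP$_\epsilon$ together with the following ones, for all $n\ge1$, $h\in\mathcal H$, $s\in S$, all $i$ in the range of positions of the operator on the left, $d\in D$, and $a\in A$ not of the form $\mathrm{cr}(d)$ or $\overline{\mathrm{cr}}(d)$; where the right-hand side has an operator with an extended history, that history has to belong to $\mathcal H$. 1. $\|^n_{h,s}(\vec x)=\delta$ if $\sigma_n(h,s)$ is undefined, and $\|^n_{h,s}(\vec x)=\lfloor\!\lfloor^{n,i}_{h,s}(\vec x)$ if $\sigma_n(h,s)=i$. 2. $\lfloor\!\lfloor^{n,i}_{h,s}(\vec x[i:=\delta])=\delta$ and $\lfloor\!\lfloor^{1,1}_{h,s}(\epsilon)=\epsilon$. 3. $\lfloor\!\lfloor^{n+1,i}_{h,s}(\vec x[i:=\epsilon])=\|^n_{h(i,n),\vartheta_{n+1}(h,s,i,\epsilon)}(x_1,\dots,x_{i-1},x_{i+1},\dots,x_{n+1})$. 4. $\lfloor\!\lfloor^{n,i}_{h,s}(\vec x[i:=a x_i'])=a'\cdot\|^n_{h(i,n),\vartheta_n(h,s,i,a)}(\vec x[i:=x_i'])$, where $a'=a$ if $a\notin C$ and $a'=\bar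 a$ if $a\in C$. 5. $\lfloor\!\lfloor^{n,i}_{h,s}(\vec x[i:=\mathrm{cr}(d) x_i'])=\overline{\mathrm{cr}}(d)\cdot\|^{n+1}_{h(i,n+1),\vartheta_n(h,s,i,\mathrm{cr}(d))}(x_1,\dots,x_{i-1},x_i',x_{i+1},\dots,x_n,\Phi(d))$. 6. $\lfloor\!\lfloor^{n,i}_{h,s}(\vec x[i:=x_i'+x_i''])=\lfloor\!\lfloor^{n,i}_{h,s}(\vec x[i:=x_i'])+\lfloor\!\lfloor^{n,i}_{h,s}(\vec x[i:=x_i''])$. **Theorem (conservative extension).** For all closed ACP$_\epsilon$ terms $t$ and $t'$, if $t=t'$ is derivable from the axioms of siACP$_\epsilon$, then $t=t'$ is derivable from the axioms of ACP$_\epsilon$. -/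

import Mathlib

universe u v w

namespace StrategicInterleaving

open FirstOrder.Language

/-! ### Equational logic over an algebraic signature -/

/-- Derivability of equations between terms, with variables from the countably infinite set `ℕ`,
from a set of equations (the axioms) in equational logic: reflexivity, symmetry, transitivity,
congruence with respect to all operators, and substitution. -/
inductive Derivable {L : FirstOrder.Language.{u, v}} (Ax : L.Term ℕ → L.Term ℕ → Prop) :
    L.Term ℕ → L.Term ℕ → Prop
  | ax {s t : L.Term ℕ} : Ax s t → Derivable Ax s t
  | refl (t : L.Term ℕ) : Derivable Ax t t
  | symm {s t : L.Term ℕ} : Derivable Ax s t → Derivable Ax t s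
  | trans {r s t : L.Term ℕ} : Derivable Ax r s → Derivable Ax s t → Derivable Ax r t
  | congr {n : ℕ} (f : L.Functions n) {ss ts : Fin n → L.Term ℕ} :
      (∀ i, Derivable Ax (ss i) (ts i)) → Derivable Ax (Term.func f ss) (Term.func f ts)
  | subst (σ : ℕ → L.Term ℕ) {s t : L.Term ℕ} :
      Derivable Ax s t → Derivable Ax (s.subst σ) (t.subst σ)

/-- A closed term (a term without variables), seen as a term over the variables `ℕ`. -/
def ofClosed {L : FirstOrder.Language.{u, v}} (t : L.Term Empty) : L.Term ℕ :=
  t.relabel Empty.elim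

/-! ### ACP with the empty process -/

/-- A communication function on `A ∪ {δ}`, where `A ∪ {δ}` is `Option A` with `none` for `δ`:
it is commutative and associative and satisfies `γ(δ, a) = δ`. -/
structure CommFun (A : Type u) where
  toFun : Option A → Option A → Option A
  comm : ∀ a b, toFun a b = toFun b a
  assoc : ∀ a b c, toFun (toFun a b) c = toFun a (toFun b c)
  delta_left : ∀ a, toFun none a = none

/-- The constants and operators of ACP with the empty process, indexed by their arity. -/
inductive ACPOp (A : Type u) : ℕ → Type u
  | delta : ACPOp A 0
  | eps : ACPOp A 0
  | act (a : A) : ACPOp A 0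
  | alt : ACPOp A 2
  | seq : ACPOp A 2
  | par : ACPOp A 2
  | leftMerge : ACPOp A 2
  | commMerge : ACPOp A 2
  | encap (H : Set A) : ACPOp A 1

/-- The signature of ACP with the empty process. -/
def acpLang (A : Type u) : FirstOrder.Language.{u, 0} := ⟨ACPOp A, fun _ => Empty⟩

section ACPTerms

variable {A : Type u} {V : Type v}

/-- The empty process. -/
def eps : (acpLang A).Term V := Term.func (L := acpLang A) ACPOp.eps ![]

/-- The constant for an element of `A ∪ {δ}`: inaction for `none`, an action otherwise. -/
def cst : Option A → (acpLang A).Term V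
  | none => Term.func (L := acpLang A) ACPOp.delta ![]
  | some a => Term.func (L := acpLang A) (ACPOp.act a) ![]

/-- Alternative composition. -/
def alt (s t : (acpLang A).Term V) : (acpLang A).Term V :=
  Term.func (L := acpLang A) ACPOp.alt ![s, t]

/-- Sequential composition. -/
def seq (s t : (acpLang A).Term V) : (acpLang A).Term V :=
  Term.func (L := acpLang A) ACPOp.seq ![s, t]

/-- Parallel composition. -/
def par (s t : (acpLang A).Term V) : (acpLang A).Term V :=
  Term.func (L := acpLang A) ACPOp.par ![s, t]

/-- Left merge. -/
def lmerge (s t : (acpLang A).Term V) : (acpLang A).Term V :=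
  Term.func (L := acpLang A) ACPOp.leftMerge ![s, t]

/-- Communication merge. -/
def cmerge (s t : (acpLang A).Term V) : (acpLang A).Term V :=
  Term.func (L := acpLang A) ACPOp.commMerge ![s, t]

/-- Encapsulation. -/
def encap (H : Set A) (t : (acpLang A).Term V) : (acpLang A).Term V :=
  Term.func (L := acpLang A) (ACPOp.encap H) ![t]

/-- The variable `x`. -/
def x : (acpLang A).Term ℕ := Term.var 0
/-- The variable `y`. -/
def y : (acpLang A).Term ℕ := Term.var 1
/-- The variable `z`. -/
def z : (acpLang A).Term ℕ := Term.var 2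

end ACPTerms

/-- The axioms of ACP with the empty process. The letters `a`, `b` range over all constants
other than `ε`, i.e. over `A ∪ {δ}`. -/
inductive ACPAxiom {A : Type u} (γ : CommFun A) :
    (acpLang A).Term ℕ → (acpLang A).Term ℕ → Prop
  | A1 : ACPAxiom γ (alt x y) (alt y x)
  | A2 : ACPAxiom γ (alt (alt x y) z) (alt x (alt y z))
  | A3 : ACPAxiom γ (alt x x) x
  | A4 : ACPAxiom γ (seq (alt x y) z) (alt (seq x z) (seq y z))
  | A5 : ACPAxiom γ (seq (seq x y) z) (seq x (seq y z))
  | A6 : ACPAxiom γ (alt x (cst none)) x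
  | A7 : ACPAxiom γ (seq (cst none) x) (cst none)
  | A8 : ACPAxiom γ (seq x eps) x
  | A9 : ACPAxiom γ (seq eps x) x
  | D0 (H : Set A) : ACPAxiom γ (encap H eps) eps
  | D1 (H : Set A) (a : Option A) (ha : ∀ b ∈ H, a ≠ some b) :
      ACPAxiom γ (encap H (cst a)) (cst a)
  | D2 (H : Set A) (a : A) (ha : a ∈ H) :
      ACPAxiom γ (encap H (cst (some a))) (cst none)
  | D3 (H : Set A) : ACPAxiom γ (encap H (alt x y)) (alt (encap H x) (encap H y))
  | D4 (H : Set A) : ACPAxiom γ (encap H (seq x y)) (seq (encap H x) (encap H y))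
  | CM1T : ACPAxiom γ (par x y)
      (alt (alt (alt (lmerge x y) (lmerge y x)) (cmerge x y))
        (seq (encap Set.univ x) (encap Set.univ y)))
  | CM2T : ACPAxiom γ (lmerge eps x) (cst none)
  | CM3 (a : Option A) : ACPAxiom γ (lmerge (seq (cst a) x) y) (seq (cst a) (par x y))
  | CM4 : ACPAxiom γ (lmerge (alt x y) z) (alt (lmerge x z) (lmerge y z))
  | CM5T : ACPAxiom γ (cmerge eps x) (cst none)
  | CM6T : ACPAxiom γ (cmerge x eps) (cst none)
  | CM7 (a b : Option A) : ACPAxiom γ (cmerge (seq (cst a) x) (seq (cst b) y))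
      (seq (cst (γ.toFun a b)) (par x y))
  | CM8 : ACPAxiom γ (cmerge (alt x y) z) (alt (cmerge x z) (cmerge y z))
  | CM9 : ACPAxiom γ (cmerge x (alt y z)) (alt (cmerge x y) (cmerge x z))
  | CM10 (a b : Option A) : ACPAxiom γ (cmerge (cst a) (cst b)) (cst (γ.toFun a b))
  | CM11 : ACPAxiom γ (cmerge (cst none) x) (cst none)
  | CM12 : ACPAxiom γ (cmerge x (cst none)) (cst none)

/-! ### Strategic interleaving -/

/-- The sequences of pairs of positive numbers that are interleaving histories. -/
inductive IsHist : List (ℕ+ × ℕ+) → Prop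
  | nil : IsHist []
  | single {i n : ℕ+} : i ≤ n → IsHist [(i, n)]
  | snoc {h : List (ℕ+ × ℕ+)} {i n j m : ℕ+} : IsHist (h ++ [(i, n)]) → j ≤ n →
      n ≤ m + 1 → m ≤ n + 1 → IsHist (h ++ [(i, n)] ++ [(j, m)])

/-- The interleaving histories, as a set of sequences. -/
def Hist : Set (List (ℕ+ × ℕ+)) := {h | IsHist h}

/-- `Extends h i n h'`: the history `h'` is `h` followed by the pair of the number of the process
at position `i` and `n`. Positions among `k` processes, which are numbered `1, …, k`, are
represented by `Fin k`; so `i : Fin k` stands for the number `i + 1`. The histories are taken from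
a given set `𝓗` of sequences. -/
def Extends {𝓗 : Set (List (ℕ+ × ℕ+))} (h : 𝓗) {k : ℕ} (i : Fin k) (n : ℕ) (h' : 𝓗) : Prop :=
  ∃ hn : 0 < n, h'.1 = h.1 ++ [(i.1.succPNat, ⟨n, hn⟩)]

/-- The strategic interleaving operators (of arity `n ≥ 1`) and the positional strategic
interleaving operators, indexed by their arity; `𝓗` is the set of histories. -/
inductive StratOp (𝓗 : Set (List (ℕ+ × ℕ+))) (S : Type v) : ℕ → Type v
  | si {n : ℕ} (hn : 0 < n) (h : 𝓗) (s : S) : StratOp 𝓗 S n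
  | pos {n : ℕ} (i : Fin n) (h : 𝓗) (s : S) : StratOp 𝓗 S n

/-- The signature consisting of the (positional) strategic interleaving operators. -/
def stratLang (𝓗 : Set (List (ℕ+ × ℕ+))) (S : Type v) : FirstOrder.Language.{v, 0} :=
  ⟨StratOp 𝓗 S, fun _ => Empty⟩

/-- The signature of the extension of ACP with the empty process by strategic interleaving. -/
abbrev siLang (A : Type u) (𝓗 : Set (List (ℕ+ × ℕ+))) (S : Type v) :
    FirstOrder.Language.{max u v, 0} :=
  (acpLang A).sum (stratLang 𝓗 S)

/-- The inclusion of ACP terms in the terms of the extension. -/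
def incl {A : Type u} (𝓗 : Set (List (ℕ+ × ℕ+))) (S : Type v) {V : Type w}
    (t : (acpLang A).Term V) : (siLang A 𝓗 S).Term V :=
  (LHom.sumInl : LHom (acpLang A) (siLang A 𝓗 S)).onTerm t

section SITerms

variable {A : Type u} {𝓗 : Set (List (ℕ+ × ℕ+))} {S : Type v} {V : Type w}

/-- Alternative composition. -/
def siAlt (s t : (siLang A 𝓗 S).Term V) : (siLang A 𝓗 S).Term V :=
  Term.func (L := siLang A 𝓗 S) (Sum.inl ACPOp.alt) ![s, t]

/-- An action followed by a process. -/
def siPrefix (a : A) (t : (siLang A 𝓗 S).Term V) : (siLang A 𝓗 S).Term V :=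
  Term.func (L := siLang A 𝓗 S) (Sum.inl ACPOp.seq) ![incl 𝓗 S (cst (some a)), t]

/-- Strategic interleaving of `n` processes. -/
def si {n : ℕ} (hn : 0 < n) (h : 𝓗) (s : S) (ts : Fin n → (siLang A 𝓗 S).Term V) :
    (siLang A 𝓗 S).Term V :=
  Term.func (L := siLang A 𝓗 S) (Sum.inr (StratOp.si hn h s)) ts

/-- Positional strategic interleaving of `n` processes. -/
def pos {n : ℕ} (i : Fin n) (h : 𝓗) (s : S) (ts : Fin n → (siLang A 𝓗 S).Term V) :
    (siLang A 𝓗 S).Term V :=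
  Term.func (L := siLang A 𝓗 S) (Sum.inr (StratOp.pos i h s)) ts

/-- The list of variables `x₁, …, xₙ`. -/
def xs (n : ℕ) : Fin n → (siLang A 𝓗 S).Term ℕ := fun j => Term.var j.1

end SITerms

/-- An interleaving strategy with process creation, for actions from `A` and communication
function `γ`: control states `S`, abstract schedulers (partial functions), control state
transformers (the last argument is from `A ∪ {ε}`, with `none` for `ε`), control actions `C` with
their traces, data `D`, process creation requests and acts, and the processes to be created. -/
structure Strategy {A : Type u} (γ : CommFun A) (𝓗 : Set (List (ℕ+ × ℕ+)))
    (S : Type v) (D : Type w) where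
  sched : (n : ℕ) → 𝓗 → S → Option (Fin n)
  upd : (n : ℕ) → 𝓗 → S → Fin n → Option A → S
  /-- the set of control actions -/
  C : Set A
  /-- the trace left by a control action -/
  bar : C → A
  bar_notMem : ∀ c, bar c ∉ C
  comm_ne_control : ∀ (c : C) (a b : A), γ.toFun (some a) (some b) ≠ some c.1
  comm_ne_bar : ∀ (c : C) (a b : A), γ.toFun (some a) (some b) ≠ some (bar c)
  comm_control : ∀ (c : C) (a : A), γ.toFun (some a) (some c.1) = none
  comm_bar : ∀ (c : C) (a : A), γ.toFun (some a) (some (bar c)) = none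
  /-- process creation requests -/
  cr : D → A
  /-- process creation acts -/
  crBar : D → A
  /-- requests for distinct data are distinct actions -/
  cr_injective : Function.Injective cr
  cr_notMem : ∀ d, cr d ∉ C ∪ Set.range bar
  crBar_notMem : ∀ d, crBar d ∉ C ∪ Set.range bar
  comm_ne_cr : ∀ (d : D) (a b : A), γ.toFun (some a) (some b) ≠ some (cr d)
  comm_ne_crBar : ∀ (d : D) (a b : A), γ.toFun (some a) (some b) ≠ some (crBar d)
  comm_cr : ∀ (d : D) (a : A), γ.toFun (some a) (some (cr d)) = none
  comm_crBar : ∀ (d : D) (a : A), γ.toFun (some a) (some (crBar d)) = none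
  /-- the closed term denoting the process to be created -/
  crea : D → (siLang A 𝓗 S).Term Empty

/-- The axioms of ACP with the empty process and strategic interleaving. In these axioms the
variable number `i` in the list `xs n` plays the role of `xᵢ` or `xᵢ'`, and the variable `n`, which
does not occur in that list, that of `xᵢ''`. The premises `Extends h i _ h'` say that the history
`h'` on the right-hand side belongs to `𝓗`, so that both sides are terms of the signature. -/
inductive SIAxiom {A : Type u} {γ : CommFun A} {𝓗 : Set (List (ℕ+ × ℕ+))}
    {S : Type v} {D : Type w} (σ : Strategy γ 𝓗 S D) :
    (siLang A 𝓗 S).Term ℕ → (siLang A 𝓗 S).Term ℕ → Prop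
  | acp {t t' : (acpLang A).Term ℕ} : ACPAxiom γ t t' → SIAxiom σ (incl 𝓗 S t) (incl 𝓗 S t')
  | SI0 {n : ℕ} (hn : 0 < n) (h : 𝓗) (s : S) : σ.sched n h s = none →
      SIAxiom σ (si hn h s (xs n)) (incl 𝓗 S (cst none))
  | SI1 {n : ℕ} (hn : 0 < n) (h : 𝓗) (s : S) (i : Fin n) : σ.sched n h s = some i →
      SIAxiom σ (si hn h s (xs n)) (pos i h s (xs n))
  | SI2 {n : ℕ} (i : Fin n) (h : 𝓗) (s : S) :
      SIAxiom σ (pos i h s (Function.update (xs n) i (incl 𝓗 S (cst none)))) (incl 𝓗 S (cst none))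
  | SI3T (i : Fin 1) (h : 𝓗) (s : S) :
      SIAxiom σ (pos i h s (fun _ => incl 𝓗 S eps)) (incl 𝓗 S eps)
  | SI4T {n : ℕ} (hn : 0 < n) (i : Fin (n + 1)) (h h' : 𝓗) (s : S) : Extends h i n h' →
      SIAxiom σ (pos i h s (Function.update (xs (n + 1)) i (incl 𝓗 S eps)))
        (si hn h' (σ.upd (n + 1) h s i none) (fun j => xs (n + 1) (i.succAbove j)))
  | SI5Ta {n : ℕ} (i : Fin n) (h h' : 𝓗) (s : S) (a : A) : Extends h i n h' →
      a ∉ Set.range σ.cr → a ∉ Set.range σ.crBar → a ∉ σ.C →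
      SIAxiom σ (pos i h s (Function.update (xs n) i (siPrefix a (xs n i))))
        (siPrefix a (si i.pos h' (σ.upd n h s i (some a)) (xs n)))
  | SI5Tb {n : ℕ} (i : Fin n) (h h' : 𝓗) (s : S) (a : σ.C) : Extends h i n h' →
      SIAxiom σ (pos i h s (Function.update (xs n) i (siPrefix a.1 (xs n i))))
        (siPrefix (σ.bar a) (si i.pos h' (σ.upd n h s i (some a.1)) (xs n)))
  | SI7 {n : ℕ} (i : Fin n) (h h' : 𝓗) (s : S) (d : D) : Extends h i (n + 1) h' →
      SIAxiom σ (pos i h s (Function.update (xs n) i (siPrefix (σ.cr d) (xs n i))))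
        (siPrefix (σ.crBar d) (si n.succ_pos h' (σ.upd n h s i (some (σ.cr d)))
          (Fin.snoc (xs n) (ofClosed (σ.crea d)))))
  | SI8 {n : ℕ} (i : Fin n) (h : 𝓗) (s : S) :
      SIAxiom σ (pos i h s (Function.update (xs n) i (siAlt (xs n i) (Term.var n))))
        (siAlt (pos i h s (xs n)) (pos i h s (Function.update (xs n) i (Term.var n))))

end StrategicInterleaving

/-!
The extension is conservative because every model of bounded depth of ACP with the empty process
carries strategic interleaving operators, and these models together separate the closed terms of
ACP that are not provably equal.

A process of depth at most `k + 1` is a finite set of capabilities: termination, or an action with a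
derivative of depth at most `k`. `Behav A X` is the type of such sets for derivatives in `X`. All
operators are given on `Behav A X` by their transition rules, which use the operators on `X` for the
derivatives. Since an argument that does not move stays in place while the result becomes a
derivative, the rules also need a projection `Behav A X → X`, which must be a homomorphism for the
axioms to hold. `Stage` collects this data, and `Stage.next` shows that it passes from `X` to
`Behav A X`. A strategic interleaving whose active process terminates makes no step, but has fewer
arguments, so recursion on the arity takes care of this case. A process that is created occurs only
in a derivative, so its behaviour is the value in `X` of the closed term for it, even if that term
refers to interleaving operators that create it again. Thus the axioms are satisfied
(`Stage.next_satisfies`), although in general no closed term of ACP describes the interleaving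
without a bound on the depth.

For the separation, the terms modulo derivability from the axioms of ACP form a semilattice
`Proc γ` under alternative composition. Every closed term is provably equal to a basic one, built
by choice and action prefix (`ProcOps.IsACP.isBasic_eval`), and a basic term is recovered up to
provable equality from its value in a model of sufficient depth by taking the supremum of its
capabilities (`Stage.exists_readback_value`). So terms with the same value in all these models are
provably equal.
-/

universe w'

namespace StrategicInterleaving

open FirstOrder.Language

/-! ### Algebras for the signature of ACP with the empty process -/

/-- The operations of ACP with the empty process on a type `X`; as in the axioms, `cst` interprets
the constants for the elements of `A ∪ {δ}`. -/
structure ProcOps (A : Type u) (X : Type w) where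
  cst : Option A → X
  eps : X
  alt : X → X → X
  seq : X → X → X
  par : X → X → X
  lmerge : X → X → X
  cmerge : X → X → X
  encap : Set A → X → X

/-- The operations `o` satisfy the axioms of ACP with the empty process. -/
structure ProcOps.IsACP {A : Type u} {X : Type w} (o : ProcOps A X) (γ : CommFun A) : Prop where
  alt_comm : ∀ p q, o.alt p q = o.alt q p
  alt_assoc : ∀ p q r, o.alt (o.alt p q) r = o.alt p (o.alt q r)
  alt_self : ∀ p, o.alt p p = p
  alt_seq : ∀ p q r, o.seq (o.alt p q) r = o.alt (o.seq p r) (o.seq q r)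
  seq_assoc : ∀ p q r, o.seq (o.seq p q) r = o.seq p (o.seq q r)
  alt_delta : ∀ p, o.alt p (o.cst none) = p
  delta_seq : ∀ p, o.seq (o.cst none) p = o.cst none
  seq_eps : ∀ p, o.seq p o.eps = p
  eps_seq : ∀ p, o.seq o.eps p = p
  encap_eps : ∀ H, o.encap H o.eps = o.eps
  encap_cst : ∀ H a, (∀ b ∈ H, a ≠ some b) → o.encap H (o.cst a) = o.cst a
  encap_cst_of_mem : ∀ H, ∀ a ∈ H, o.encap H (o.cst (some a)) = o.cst none
  encap_alt : ∀ H p q, o.encap H (o.alt p q) = o.alt (o.encap H p) (o.encap H q)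
  encap_seq : ∀ H p q, o.encap H (o.seq p q) = o.seq (o.encap H p) (o.encap H q)
  par_eq : ∀ p q, o.par p q = o.alt (o.alt (o.alt (o.lmerge p q) (o.lmerge q p)) (o.cmerge p q))
    (o.seq (o.encap Set.univ p) (o.encap Set.univ q))
  eps_lmerge : ∀ p, o.lmerge o.eps p = o.cst none
  cst_seq_lmerge : ∀ a p q, o.lmerge (o.seq (o.cst a) p) q = o.seq (o.cst a) (o.par p q)
  alt_lmerge : ∀ p q r, o.lmerge (o.alt p q) r = o.alt (o.lmerge p r) (o.lmerge q r)
  eps_cmerge : ∀ p, o.cmerge o.eps p = o.cst none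
  cmerge_eps : ∀ p, o.cmerge p o.eps = o.cst none
  cst_seq_cmerge_cst_seq : ∀ a b p q,
    o.cmerge (o.seq (o.cst a) p) (o.seq (o.cst b) q) = o.seq (o.cst (γ.toFun a b)) (o.par p q)
  alt_cmerge : ∀ p q r, o.cmerge (o.alt p q) r = o.alt (o.cmerge p r) (o.cmerge q r)
  cmerge_alt : ∀ p q r, o.cmerge p (o.alt q r) = o.alt (o.cmerge p q) (o.cmerge p r)
  cst_cmerge_cst : ∀ a b, o.cmerge (o.cst a) (o.cst b) = o.cst (γ.toFun a b)
  delta_cmerge : ∀ p, o.cmerge (o.cst none) p = o.cst none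
  cmerge_delta : ∀ p, o.cmerge p (o.cst none) = o.cst none

/-- The map `f` preserves the operations of ACP with the empty process. -/
structure ProcOps.IsHom {A : Type u} {X : Type v} {Y : Type w} (o : ProcOps A X)
    (o' : ProcOps A Y) (f : X → Y) : Prop where
  cst : ∀ a, f (o.cst a) = o'.cst a
  eps : f o.eps = o'.eps
  alt : ∀ p q, f (o.alt p q) = o'.alt (f p) (f q)
  seq : ∀ p q, f (o.seq p q) = o'.seq (f p) (f q)
  par : ∀ p q, f (o.par p q) = o'.par (f p) (f q)
  lmerge : ∀ p q, f (o.lmerge p q) = o'.lmerge (f p) (f q)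
  cmerge : ∀ p q, f (o.cmerge p q) = o'.cmerge (f p) (f q)
  encap : ∀ H p, f (o.encap H p) = o'.encap H (f p)

/-- The structure in the sense of model theory given by operations of ACP. -/
@[reducible]
def ProcOps.toStructure {A : Type u} {X : Type w} (o : ProcOps A X) : (acpLang A).Structure X where
  funMap {_} f := match f with
    | ACPOp.delta => fun _ => o.cst none
    | ACPOp.eps => fun _ => o.eps
    | ACPOp.act a => fun _ => o.cst (some a)
    | ACPOp.alt => fun p => o.alt (p 0) (p 1)
    | ACPOp.seq => fun p => o.seq (p 0) (p 1)
    | ACPOp.par => fun p => o.par (p 0) (p 1)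
    | ACPOp.leftMerge => fun p => o.lmerge (p 0) (p 1)
    | ACPOp.commMerge => fun p => o.cmerge (p 0) (p 1)
    | ACPOp.encap H => fun p => o.encap H (p 0)
  RelMap r := r.elim

/-- The value of a term under a valuation of its variables. -/
def ProcOps.eval {A : Type u} {X : Type v} {V : Type w} (o : ProcOps A X) (v : V → X)
    (t : (acpLang A).Term V) : X :=
  letI := o.toStructure
  t.realize v

section Eval

variable {A : Type u} {X : Type v} {V : Type w} (o : ProcOps A X) (v : V → X)

@[simp] theorem ProcOps.eval_var (i : V) : o.eval v (Term.var i) = v i := rfl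
@[simp] theorem ProcOps.eval_cst (a : Option A) :
    o.eval v (StrategicInterleaving.cst a) = o.cst a := by
  cases a <;> rfl
@[simp] theorem ProcOps.eval_eps : o.eval v StrategicInterleaving.eps = o.eps := rfl
@[simp] theorem ProcOps.eval_alt (s t : (acpLang A).Term V) :
    o.eval v (StrategicInterleaving.alt s t) = o.alt (o.eval v s) (o.eval v t) := rfl
@[simp] theorem ProcOps.eval_seq (s t : (acpLang A).Term V) :
    o.eval v (StrategicInterleaving.seq s t) = o.seq (o.eval v s) (o.eval v t) := rfl
@[simp] theorem ProcOps.eval_par (s t : (acpLang A).Term V) :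
    o.eval v (StrategicInterleaving.par s t) = o.par (o.eval v s) (o.eval v t) := rfl
@[simp] theorem ProcOps.eval_lmerge (s t : (acpLang A).Term V) :
    o.eval v (StrategicInterleaving.lmerge s t) = o.lmerge (o.eval v s) (o.eval v t) := rfl
@[simp] theorem ProcOps.eval_cmerge (s t : (acpLang A).Term V) :
    o.eval v (StrategicInterleaving.cmerge s t) = o.cmerge (o.eval v s) (o.eval v t) := rfl
@[simp] theorem ProcOps.eval_encap (H : Set A) (t : (acpLang A).Term V) :
    o.eval v (StrategicInterleaving.encap H t) = o.encap H (o.eval v t) := rfl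

end Eval

theorem ProcOps.IsACP.eval_eq {A : Type u} {X : Type v} {o : ProcOps A X} {γ : CommFun A}
    (h : o.IsACP γ) {s t : (acpLang A).Term ℕ} (hst : ACPAxiom γ s t) (v : ℕ → X) :
    o.eval v s = o.eval v t := by
  cases hst <;> simp only [x, y, z, eval_var, eval_cst, eval_eps, eval_alt, eval_seq, eval_par,
    eval_lmerge, eval_cmerge, eval_encap]
  case A1 => exact h.alt_comm _ _
  case A2 => exact h.alt_assoc _ _ _
  case A3 => exact h.alt_self _
  case A4 => exact h.alt_seq _ _ _
  case A5 => exact h.seq_assoc _ _ _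
  case A6 => exact h.alt_delta _
  case A7 => exact h.delta_seq _
  case A8 => exact h.seq_eps _
  case A9 => exact h.eps_seq _
  case D0 => exact h.encap_eps _
  case D1 ha => exact h.encap_cst _ _ ha
  case D2 ha => exact h.encap_cst_of_mem _ _ ha
  case D3 => exact h.encap_alt _ _ _
  case D4 => exact h.encap_seq _ _ _
  case CM1T => exact h.par_eq _ _
  case CM2T => exact h.eps_lmerge _
  case CM3 => exact h.cst_seq_lmerge _ _ _
  case CM4 => exact h.alt_lmerge _ _ _
  case CM5T => exact h.eps_cmerge _
  case CM6T => exact h.cmerge_eps _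
  case CM7 => exact h.cst_seq_cmerge_cst_seq _ _ _ _
  case CM8 => exact h.alt_cmerge _ _ _
  case CM9 => exact h.cmerge_alt _ _ _
  case CM10 => exact h.cst_cmerge_cst _ _
  case CM11 => exact h.delta_cmerge _
  case CM12 => exact h.cmerge_delta _

/-- Equational logic is sound. -/
theorem Derivable.realize_eq {L : FirstOrder.Language.{u, v}} {X : Type w} [L.Structure X]
    {Ax : L.Term ℕ → L.Term ℕ → Prop}
    (hAx : ∀ s t, Ax s t → ∀ v : ℕ → X, s.realize v = t.realize v) {s t : L.Term ℕ}
    (h : Derivable Ax s t) : ∀ v : ℕ → X, s.realize v = t.realize v := by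
  induction h with
  | ax h => exact hAx _ _ h
  | refl => exact fun _ => rfl
  | symm _ ih => exact fun v => (ih v).symm
  | trans _ _ ih₁ ih₂ => exact fun v => (ih₁ v).trans (ih₂ v)
  | congr f _ ih => exact fun v => congrArg (Structure.funMap f) (funext fun i => ih i v)
  | subst σ _ ih => intro v; simpa using ih _

/-! ### One step of behaviour -/

/-- A process whose derivatives are elements of `X`, given by the set of its initial
capabilities: `none` is termination, and `some (a, p)` is the action `a` followed by `p`. -/
abbrev Behav (A : Type u) (X : Type w) : Type (max u w) := Finset (Option (A × X))

section

variable {A : Type u} {X : Type v} {Y : Type w}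

open Classical in
/-- The action of `Behav A` on maps. -/
noncomputable def Behav.map (f : X → Y) (P : Behav A X) : Behav A Y :=
  P.image (Option.map (Prod.map id f))

/-- The constant `a ∈ A ∪ {δ}` followed by `p`. -/
def Behav.step (a : Option A) (p : X) : Behav A X :=
  a.elim ∅ fun a => {some (a, p)}

open Classical in
/-- The operations of ACP on one-step behaviours, where the operations `o` are applied to the
derivatives. An argument that does not move has to become a derivative, which is the purpose of the
map `τ` that forgets the last step of a behaviour. -/
noncomputable def ProcOps.next (γ : CommFun A) (o : ProcOps A X) (τ : Behav A X → X) :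
    ProcOps A (Behav A X) :=
  let seq : Behav A X → Behav A X → Behav A X := fun P Q =>
    P.biUnion fun e => e.elim Q fun e => {some (e.1, o.seq e.2 (τ Q))}
  let lmerge : Behav A X → Behav A X → Behav A X := fun P Q =>
    P.biUnion fun e => e.elim ∅ fun e => {some (e.1, o.par e.2 (τ Q))}
  let cmerge : Behav A X → Behav A X → Behav A X := fun P Q =>
    P.biUnion fun e => Q.biUnion fun e' => e.elim ∅ fun e => e'.elim ∅ fun e' =>
      Behav.step (γ.toFun (some e.1) (some e'.1)) (o.par e.2 e'.2)
  let encap : Set A → Behav A X → Behav A X := fun H P =>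
    P.biUnion fun e => e.elim {none} fun e => if e.1 ∈ H then ∅ else {some (e.1, o.encap H e.2)}
  { cst := fun a => Behav.step a o.eps
    eps := {none}
    alt := fun P Q => P ∪ Q
    seq := seq
    lmerge := lmerge
    cmerge := cmerge
    encap := encap
    par := fun P Q =>
      lmerge P Q ∪ lmerge Q P ∪ cmerge P Q ∪ seq (encap Set.univ P) (encap Set.univ Q) }

@[simp] theorem Behav.step_none (p : X) : Behav.step (none : Option A) p = ∅ := rfl
@[simp] theorem Behav.step_some (a : A) (p : X) : Behav.step (some a) p = {some (a, p)} := rfl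

@[simp] theorem Behav.map_empty (f : X → Y) : Behav.map f (∅ : Behav A X) = ∅ := rfl

@[simp] theorem Behav.map_none (f : X → Y) : Behav.map f ({none} : Behav A X) = {none} := by
  simp [Behav.map]

@[simp] theorem Behav.map_some (f : X → Y) (a : A) (p : X) :
    Behav.map f {some (a, p)} = {some (a, f p)} := by
  simp [Behav.map]

@[simp] theorem Behav.map_step (f : X → Y) (a : Option A) (p : X) :
    Behav.map f (Behav.step a p) = Behav.step a (f p) := by
  cases a <;> simp

open Classical in
theorem Behav.map_union (f : X → Y) (P Q : Behav A X) :
    Behav.map f (P ∪ Q) = Behav.map f P ∪ Behav.map f Q := by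
  simp [Behav.map, Finset.image_union]

open Classical in
/-- All operators on one-step behaviours collect the contributions of the capabilities of an
argument, so that it suffices to compare these contributions. -/
theorem Behav.map_biUnion_eq (f : X → Y) {P : Behav A X} {b : Option (A × X) → Behav A X}
    {c : Option (A × Y) → Behav A Y}
    (h : ∀ e, Behav.map f (b e) = c (e.map (Prod.map id f))) :
    Behav.map f (P.biUnion b) = (Behav.map f P).biUnion c := by
  simp only [Behav.map, Finset.biUnion_image, Finset.image_biUnion]
  exact Finset.biUnion_congr rfl fun e _ => by simpa only [Behav.map] using h e

variable {γ : CommFun A} {o : ProcOps A X} {o' : ProcOps A Y} {τ : Behav A X → X}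
  {τ' : Behav A Y → Y}

open Classical in
/-- The one-step operations are functorial. -/
theorem ProcOps.IsHom.next {f : X → Y} (h : o.IsHom o' f)
    (hτ : ∀ P, f (τ P) = τ' (Behav.map f P)) :
    (o.next γ τ).IsHom (o'.next γ τ') (Behav.map f) := by
  have hseq : ∀ P Q, Behav.map f ((o.next γ τ).seq P Q) =
      (o'.next γ τ').seq (Behav.map f P) (Behav.map f Q) := fun P Q =>
    Behav.map_biUnion_eq f fun e => by rcases e with _ | ⟨a, p⟩ <;> simp [h.seq, hτ]
  have hlm : ∀ P Q, Behav.map f ((o.next γ τ).lmerge P Q) =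
      (o'.next γ τ').lmerge (Behav.map f P) (Behav.map f Q) := fun P Q =>
    Behav.map_biUnion_eq f fun e => by rcases e with _ | ⟨a, p⟩ <;> simp [h.par, hτ]
  have hcm : ∀ P Q, Behav.map f ((o.next γ τ).cmerge P Q) =
      (o'.next γ τ').cmerge (Behav.map f P) (Behav.map f Q) := fun P Q =>
    Behav.map_biUnion_eq f fun e => Behav.map_biUnion_eq f fun e' => by
      rcases e with _ | ⟨a, p⟩ <;> rcases e' with _ | ⟨b, q⟩ <;> simp [h.par]
  have henc : ∀ H P, Behav.map f ((o.next γ τ).encap H P) =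
      (o'.next γ τ').encap H (Behav.map f P) := fun H P =>
    Behav.map_biUnion_eq f fun e => by
      rcases e with _ | ⟨a, p⟩
      · simp
      · by_cases ha : a ∈ H <;> simp [ha, h.encap]
  refine ⟨fun a => ?_, Behav.map_none f, Behav.map_union f, hseq, fun P Q => ?_, hlm, hcm, henc⟩
  · exact (Behav.map_step f a o.eps).trans (by rw [h.eps]; rfl)
  · change Behav.map f ((o.next γ τ).lmerge P Q ∪ (o.next γ τ).lmerge Q P ∪
      (o.next γ τ).cmerge P Q ∪
      (o.next γ τ).seq ((o.next γ τ).encap Set.univ P) ((o.next γ τ).encap Set.univ Q)) = _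
    rw [Behav.map_union, Behav.map_union, Behav.map_union, hseq, hlm, hlm, hcm, henc, henc]
    rfl

theorem ProcOps.next_cst_seq (ho : o.IsACP γ) (a : Option A) (P : Behav A X) :
    (o.next γ τ).seq ((o.next γ τ).cst a) P = Behav.step a (τ P) := by
  cases a <;> simp [ProcOps.next, ho.eps_seq]

open Classical in
theorem ProcOps.next_seq (P Q : Behav A X) : (o.next γ τ).seq P Q =
    P.biUnion fun e => e.elim Q fun e => {some (e.1, o.seq e.2 (τ Q))} := rfl

open Classical in
theorem ProcOps.next_encap (H : Set A) (P : Behav A X) : (o.next γ τ).encap H P =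
    P.biUnion fun e => e.elim {none} fun e =>
      if e.1 ∈ H then ∅ else {some (e.1, o.encap H e.2)} := rfl

open Classical in
theorem ProcOps.next_biUnion_seq (P : Behav A X) (b : Option (A × X) → Behav A X)
    (Q : Behav A X) :
    (o.next γ τ).seq (P.biUnion b) Q = P.biUnion fun e => (o.next γ τ).seq (b e) Q :=
  Finset.biUnion_biUnion ..

open Classical in
theorem ProcOps.next_encap_biUnion (H : Set A) (P : Behav A X)
    (b : Option (A × X) → Behav A X) :
    (o.next γ τ).encap H (P.biUnion b) = P.biUnion fun e => (o.next γ τ).encap H (b e) :=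
  Finset.biUnion_biUnion ..

@[simp] theorem ProcOps.next_eps_seq (P : Behav A X) : (o.next γ τ).seq {none} P = P := by
  simp [ProcOps.next]

@[simp] theorem ProcOps.next_some_seq (a : A) (p : X) (P : Behav A X) :
    (o.next γ τ).seq {some (a, p)} P = {some (a, o.seq p (τ P))} := by
  simp [ProcOps.next]

@[simp] theorem ProcOps.next_empty_seq (P : Behav A X) : (o.next γ τ).seq ∅ P = ∅ := rfl

@[simp] theorem ProcOps.next_encap_eps (H : Set A) : (o.next γ τ).encap H {none} = {none} := by
  simp [ProcOps.next]

open Classical in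
@[simp] theorem ProcOps.next_encap_some (H : Set A) (a : A) (p : X) :
    (o.next γ τ).encap H {some (a, p)} = if a ∈ H then ∅ else {some (a, o.encap H p)} := by
  simp [ProcOps.next]

theorem biUnion_eq_empty {ι κ : Type*} [DecidableEq κ] {s : Finset ι} {f : ι → Finset κ}
    (h : ∀ i ∈ s, f i = ∅) : s.biUnion f = ∅ := by
  simpa [Finset.eq_empty_iff_forall_notMem] using
    fun k i hi => by simp [h i hi]

theorem ProcOps.IsACP.eps_par_eps (ho : o.IsACP γ) : o.par o.eps o.eps = o.eps := by
  simp only [ho.par_eq, ho.eps_lmerge, ho.eps_cmerge, ho.encap_eps, ho.eps_seq, ho.alt_self]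
  rw [ho.alt_comm, ho.alt_delta]

open Classical in
/-- The passage to one-step behaviours preserves the validity of the axioms of ACP. In the axioms
with nested operators an operator is applied to the projection of the result of another one, hence
the need for `τ` to be a homomorphism. -/
theorem ProcOps.IsACP.next (ho : o.IsACP γ) (hτ : (o.next γ τ).IsHom o τ) :
    (o.next γ τ).IsACP γ where
  alt_comm P Q := Finset.union_comm P Q
  alt_assoc P Q R := Finset.union_assoc P Q R
  alt_self P := Finset.union_self P
  alt_seq P Q R := Finset.union_biUnion
  alt_delta P := Finset.union_empty P
  delta_seq P := rfl
  seq_eps P := by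
    refine (Finset.biUnion_congr rfl fun e _ => ?_).trans Finset.biUnion_singleton_eq_self
    rcases e with _ | ⟨a, p⟩
    · rfl
    · simp [hτ.eps, ho.seq_eps]
  eps_seq P := by simp [ProcOps.next]
  seq_assoc P Q R := by
    rw [next_seq P Q, next_biUnion_seq, next_seq P]
    refine Finset.biUnion_congr rfl fun e _ => ?_
    rcases e with _ | ⟨a, p⟩
    · rfl
    · simp [hτ.seq, ho.seq_assoc]
  encap_eps H := by simp [ProcOps.next]
  encap_cst H a ha := by
    rcases a with _ | a
    · rfl
    · have : a ∉ H := fun h => ha a h rfl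
      simp [ProcOps.next, this, ho.encap_eps]
  encap_cst_of_mem H a ha := by simp [ProcOps.next, ha]
  encap_alt H P Q := Finset.union_biUnion
  encap_seq H P Q := by
    rw [next_seq P Q, next_encap_biUnion, next_encap H P, next_biUnion_seq]
    refine Finset.biUnion_congr rfl fun e _ => ?_
    rcases e with _ | ⟨a, p⟩
    · simp
    · by_cases ha : a ∈ H <;> simp [ha, ho.encap_seq, hτ.encap]
  par_eq P Q := rfl
  eps_lmerge P := by simp [ProcOps.next]
  cst_seq_lmerge a P Q := by
    rw [next_cst_seq ho, next_cst_seq ho, hτ.par]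
    cases a <;> simp [ProcOps.next]
  alt_lmerge P Q R := Finset.union_biUnion
  eps_cmerge P := by
    simpa [ProcOps.next] using biUnion_eq_empty fun _ _ => rfl
  cmerge_eps P := biUnion_eq_empty fun e _ => biUnion_eq_empty fun e' he' => by
    obtain rfl := Finset.mem_singleton.1 he'
    rcases e with _ | ⟨a, p⟩ <;> rfl
  cst_seq_cmerge_cst_seq a b P Q := by
    rw [next_cst_seq ho, next_cst_seq ho, next_cst_seq ho, hτ.par]
    cases a <;> cases b <;> simp [ProcOps.next, γ.delta_left, γ.comm _ none]
  alt_cmerge P Q R := Finset.union_biUnion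
  cmerge_alt P Q R := by
    ext e
    simp only [ProcOps.next, Finset.mem_biUnion, Finset.mem_union, or_and_right, exists_or,
      and_or_left]
  cst_cmerge_cst a b := by
    cases a <;> cases b <;> simp [ProcOps.next, γ.delta_left, γ.comm _ none, ho.eps_par_eps]
  delta_cmerge P := rfl
  cmerge_delta P := biUnion_eq_empty fun _ _ => rfl

end

/-! ### Strategic interleaving on behaviours -/

theorem Extends.unique {𝓗 : Set (List (ℕ+ × ℕ+))} {h h₁ h₂ : 𝓗} {k n : ℕ} {i : Fin k}
    (H₁ : Extends h i n h₁) (H₂ : Extends h i n h₂) : h₁ = h₂ := by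
  obtain ⟨_, H₁⟩ := H₁
  obtain ⟨_, H₂⟩ := H₂
  exact Subtype.ext (H₁.trans H₂.symm)

open Classical in
/-- The extension of the history `h` by the pair of (the number of) `i` and `n`, if it exists
in `𝓗`. -/
noncomputable def extend {𝓗 : Set (List (ℕ+ × ℕ+))} (h : 𝓗) {k : ℕ} (i : Fin k) (n : ℕ) :
    Option 𝓗 :=
  if H : ∃ h', Extends h i n h' then some H.choose else none

theorem Extends.extend_eq {𝓗 : Set (List (ℕ+ × ℕ+))} {h h' : 𝓗} {k n : ℕ} {i : Fin k}
    (H : Extends h i n h') : extend h i n = some h' := by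
  have H' : ∃ h', Extends h i n h' := ⟨h', H⟩
  rw [extend, dif_pos H', H'.choose_spec.unique H]

/-- The strategic interleaving operators and their positional versions on a type `X`. For arity
`0` there is no operator in the signature, so the value `si 0` plays no role. -/
structure InterleavingOps (𝓗 : Set (List (ℕ+ × ℕ+))) (S : Type v) (X : Type w) where
  si : (n : ℕ) → 𝓗 → S → (Fin n → X) → X
  pos : (n : ℕ) → Fin n → 𝓗 → S → (Fin n → X) → X

/-- The structure in the sense of model theory given by strategic interleaving operators. -/
@[reducible]
def InterleavingOps.toStructure {𝓗 : Set (List (ℕ+ × ℕ+))} {S : Type v} {X : Type w}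
    (u : InterleavingOps 𝓗 S X) : (stratLang 𝓗 S).Structure X where
  funMap {n} f := match f with
    | StratOp.si _ h s => u.si n h s
    | StratOp.pos i h s => u.pos n i h s
  RelMap r := r.elim

/-- The value of a term of the extended signature under a valuation of its variables. -/
def siEval {A : Type u} {𝓗 : Set (List (ℕ+ × ℕ+))} {S : Type v} {X : Type w} {V : Type w'}
    (o : ProcOps A X) (u : InterleavingOps 𝓗 S X) (v : V → X) (t : (siLang A 𝓗 S).Term V) : X :=
  letI := o.toStructure
  letI := u.toStructure
  t.realize v

section

variable {A : Type u} {𝓗 : Set (List (ℕ+ × ℕ+))} {S : Type v} {X : Type w} {V : Type w'}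
  (o : ProcOps A X) (u : InterleavingOps 𝓗 S X) (v : V → X)

theorem siEval_incl (t : (acpLang A).Term V) : siEval o u v (incl 𝓗 S t) = o.eval v t := by
  let := o.toStructure
  let := u.toStructure
  exact LHom.realize_onTerm (LHom.sumInl : LHom (acpLang A) (siLang A 𝓗 S)) t v

theorem siEval_ofClosed (v : ℕ → X) (t : (siLang A 𝓗 S).Term Empty) :
    siEval o u v (ofClosed t) = siEval o u Empty.elim t := by
  let := o.toStructure
  let := u.toStructure
  simp only [siEval, ofClosed, Term.realize_relabel]
  congr 1
  exact funext fun e => e.elim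

theorem eval_ofClosed (v : ℕ → X) (t : (acpLang A).Term Empty) :
    o.eval v (ofClosed t) = o.eval Empty.elim t := by
  let := o.toStructure
  simp only [ProcOps.eval, ofClosed, Term.realize_relabel]
  congr 1
  exact funext fun e => e.elim

@[simp] theorem siEval_siAlt (s t : (siLang A 𝓗 S).Term V) :
    siEval o u v (siAlt s t) = o.alt (siEval o u v s) (siEval o u v t) := rfl

@[simp] theorem siEval_siPrefix (a : A) (t : (siLang A 𝓗 S).Term V) :
    siEval o u v (siPrefix a t) = o.seq (o.cst (some a)) (siEval o u v t) := rfl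

@[simp] theorem siEval_si {n : ℕ} (hn : 0 < n) (h : 𝓗) (s : S)
    (ts : Fin n → (siLang A 𝓗 S).Term V) :
    siEval o u v (si hn h s ts) = u.si n h s fun j => siEval o u v (ts j) := rfl

@[simp] theorem siEval_pos {n : ℕ} (i : Fin n) (h : 𝓗) (s : S)
    (ts : Fin n → (siLang A 𝓗 S).Term V) :
    siEval o u v (pos i h s ts) = u.pos n i h s fun j => siEval o u v (ts j) := rfl

theorem siEval_update {n : ℕ} (ts : Fin n → (siLang A 𝓗 S).Term V) (i : Fin n)
    (t : (siLang A 𝓗 S).Term V) :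
    (fun j => siEval o u v (Function.update ts i t j)) =
      Function.update (fun j => siEval o u v (ts j)) i (siEval o u v t) := by
  funext j
  rcases eq_or_ne j i with rfl | hj
  · simp
  · simp [hj]

theorem siEval_snoc {n : ℕ} (ts : Fin n → (siLang A 𝓗 S).Term V) (t : (siLang A 𝓗 S).Term V) :
    (fun j => siEval o u v (Fin.snoc (α := fun _ => (siLang A 𝓗 S).Term V) ts t j)) =
      Fin.snoc (α := fun _ => X) (fun j => siEval o u v (ts j)) (siEval o u v t) := by
  funext j
  refine Fin.lastCases ?_ (fun j => ?_) j <;> simp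

/-- The map `f` preserves the strategic interleaving operators. -/
structure InterleavingOps.IsHom {Y : Type*} (u : InterleavingOps 𝓗 S X)
    (u' : InterleavingOps 𝓗 S Y) (f : X → Y) : Prop where
  si : ∀ n h s p, f (u.si n h s p) = u'.si n h s (f ∘ p)
  pos : ∀ n i h s p, f (u.pos n i h s p) = u'.pos n i h s (f ∘ p)

variable {o u} in
theorem siEval_hom {Y : Type*} {o' : ProcOps A Y} {u' : InterleavingOps 𝓗 S Y} {f : X → Y}
    (ho : o.IsHom o' f) (hu : u.IsHom u' f) (t : (siLang A 𝓗 S).Term V) :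
    f (siEval o u v t) = siEval o' u' (f ∘ v) t := by
  induction t with
  | var => rfl
  | @func n g ts ih =>
    rcases g with g | g
    · cases g
      case delta => exact ho.cst none
      case eps => exact ho.eps
      case act a => exact ho.cst (some a)
      case alt => exact (ho.alt _ _).trans (congrArg₂ o'.alt (ih 0) (ih 1))
      case seq => exact (ho.seq _ _).trans (congrArg₂ o'.seq (ih 0) (ih 1))
      case par => exact (ho.par _ _).trans (congrArg₂ o'.par (ih 0) (ih 1))
      case leftMerge => exact (ho.lmerge _ _).trans (congrArg₂ o'.lmerge (ih 0) (ih 1))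
      case commMerge => exact (ho.cmerge _ _).trans (congrArg₂ o'.cmerge (ih 0) (ih 1))
      case encap H => exact (ho.encap _ _).trans (congrArg (o'.encap H) (ih 0))
    · cases g
      case si hn h s => exact (hu.si _ _ _ _).trans (congrArg (u'.si _ h s) (funext ih))
      case pos i h s => exact (hu.pos _ _ _ _ _).trans (congrArg (u'.pos _ i h s) (funext ih))

end

section

variable {A : Type u} {γ : CommFun A} {𝓗 : Set (List (ℕ+ × ℕ+))} {S : Type v} {D : Type w}
  {X : Type u} (σ : Strategy γ 𝓗 S D)

open Classical in
/-- The visible effect of the execution of `a`: a control action leaves its trace. -/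
noncomputable def Strategy.trace (a : A) : A := if h : a ∈ σ.C then σ.bar ⟨a, h⟩ else a

open Classical in
/-- The behaviour of an interleaving of the processes `p` in which the process at position `i`
executes the action `a` and becomes `q`; `φ` gives the created processes. The choice of the datum
for a request is unique by injectivity of `cr`. Two cases are not subject to the axioms: if the
extended history is not in `𝓗`, the result is inaction, and a process creation act that is not a
request is executed as an ordinary action. -/
noncomputable def Strategy.act (u : InterleavingOps 𝓗 S X) (φ : D → X) {n : ℕ} (i : Fin n)
    (h : 𝓗) (s : S) (p : Fin n → X) (a : A) (q : X) : Behav A X :=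
  if hd : ∃ d, σ.cr d = a then
    (extend h i (n + 1)).elim ∅ fun h' => {some (σ.crBar hd.choose,
      u.si (n + 1) h' (σ.upd n h s i (some a))
        (Fin.snoc (α := fun _ => X) (Function.update p i q) (φ hd.choose)))}
  else
    (extend h i n).elim ∅ fun h' => {some (σ.trace a,
      u.si n h' (σ.upd n h s i (some a)) (Function.update p i q))}

/-- The behaviour of an interleaving of the processes `p` in which the process at position `i`
terminates; `r` interleaves the remaining processes. If there is no other process, the
interleaving terminates as well. -/
noncomputable def Strategy.term {n : ℕ} (r : 𝓗 → S → (Fin n → Behav A X) → Behav A X)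
    (i : Fin (n + 1)) (h : 𝓗) (s : S) (p : Fin (n + 1) → Behav A X) : Behav A X :=
  if n = 0 then {none}
  else (extend h i n).elim ∅ fun h' =>
    r h' (σ.upd (n + 1) h s i none) fun j => p (i.succAbove j)

open Classical in
/-- The positional interleaving of `n + 1` behaviours, in terms of an interleaving `r` of `n`
behaviours. -/
noncomputable def Strategy.posOf (u : InterleavingOps 𝓗 S X) (φ : D → X) (τ : Behav A X → X)
    {n : ℕ} (r : 𝓗 → S → (Fin n → Behav A X) → Behav A X)
    (i : Fin (n + 1)) (h : 𝓗) (s : S) (p : Fin (n + 1) → Behav A X) : Behav A X :=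
  (p i).biUnion fun e => e.elim (σ.term r i h s p) fun e => σ.act u φ i h s (τ ∘ p) e.1 e.2

/-- The interleaving of `n` behaviours, by recursion on `n`: the number of processes decreases
when a process terminates, and an action leads to derivatives, which `u` interleaves. -/
noncomputable def Strategy.nextSI (u : InterleavingOps 𝓗 S X) (φ : D → X) (τ : Behav A X → X) :
    (n : ℕ) → 𝓗 → S → (Fin n → Behav A X) → Behav A X
  | 0, _, _, _ => ∅
  | n + 1, h, s, p => (σ.sched (n + 1) h s).elim ∅ fun i =>
      σ.posOf u φ τ (nextSI u φ τ n) i h s p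

/-- The strategic interleaving operators on one-step behaviours, given those on derivatives. -/
noncomputable def Strategy.next (u : InterleavingOps 𝓗 S X) (φ : D → X) (τ : Behav A X → X) :
    InterleavingOps 𝓗 S (Behav A X) where
  si := σ.nextSI u φ τ
  pos n := match n with
    | 0 => fun i => i.elim0
    | n + 1 => σ.posOf u φ τ (σ.nextSI u φ τ n)

variable {σ} {u : InterleavingOps 𝓗 S X} {φ : D → X} {τ : Behav A X → X}

theorem Strategy.map_act {Y : Type u} {u' : InterleavingOps 𝓗 S Y} {φ' : D → Y} {f : X → Y}
    (hu : u.IsHom u' f) (hφ : ∀ d, f (φ d) = φ' d) {n : ℕ} (i : Fin n)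
    (h : 𝓗) (s : S) (p : Fin n → X) (a : A) (q : X) :
    Behav.map f (σ.act u φ i h s p a q) = σ.act u' φ' i h s (f ∘ p) a (f q) := by
  unfold Strategy.act
  split_ifs with hd
  · rcases extend h i (n + 1) with _ | h'
    · simp
    · simp [hu.si, ← hφ, Fin.comp_snoc, Function.comp_update]
  · rcases extend h i n with _ | h'
    · simp
    · simp [hu.si, Function.comp_update]

theorem Strategy.map_posOf {Y : Type u} {u' : InterleavingOps 𝓗 S Y} {φ' : D → Y} {f : X → Y}
    {τ' : Behav A Y → Y} (hu : u.IsHom u' f) (hφ : ∀ d, f (φ d) = φ' d)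
    (hτ : ∀ P, f (τ P) = τ' (Behav.map f P)) {n : ℕ}
    {r : 𝓗 → S → (Fin n → Behav A X) → Behav A X}
    {r' : 𝓗 → S → (Fin n → Behav A Y) → Behav A Y}
    (hr : ∀ h s p, Behav.map f (r h s p) = r' h s (Behav.map f ∘ p))
    (i : Fin (n + 1)) (h : 𝓗) (s : S) (p : Fin (n + 1) → Behav A X) :
    Behav.map f (σ.posOf u φ τ r i h s p) = σ.posOf u' φ' τ' r' i h s (Behav.map f ∘ p) :=
  Behav.map_biUnion_eq f fun e => by
    rcases e with _ | ⟨a, q⟩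
    · simp only [Option.elim, Option.map, Strategy.term]
      split_ifs
      · simp
      · rcases extend h i n with _ | h'
        · simp
        · simp [hr, Function.comp_def]
    · simp [Strategy.map_act hu hφ, Function.comp_def, hτ]

theorem Strategy.next_isHom {Y : Type u} {u' : InterleavingOps 𝓗 S Y} {φ' : D → Y} {f : X → Y}
    {τ' : Behav A Y → Y} (hu : u.IsHom u' f) (hφ : ∀ d, f (φ d) = φ' d)
    (hτ : ∀ P, f (τ P) = τ' (Behav.map f P)) :
    (σ.next u φ τ).IsHom (σ.next u' φ' τ') (Behav.map f) := by
  have hsi : ∀ n h s p, Behav.map f (σ.nextSI u φ τ n h s p) =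
      σ.nextSI u' φ' τ' n h s (Behav.map f ∘ p) := by
    intro n
    induction n with
    | zero => intros; rfl
    | succ n ih =>
      intro h s p
      simp only [Strategy.nextSI]
      rcases σ.sched (n + 1) h s with _ | i
      · rfl
      · exact Strategy.map_posOf hu hφ hτ ih i h s p
  refine ⟨hsi, fun n i h s p => ?_⟩
  cases n with
  | zero => exact i.elim0
  | succ n => exact Strategy.map_posOf hu hφ hτ (hsi n) i h s p

open Classical in
/-- The argument at the active position matters only through the union over its capabilities. -/
theorem Strategy.next_pos_update_union {n : ℕ} (i : Fin n) (h : 𝓗) (s : S)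
    (p : Fin n → Behav A X) (P Q : Behav A X) :
    (σ.next u φ τ).pos n i h s (Function.update p i (P ∪ Q)) =
      (σ.next u φ τ).pos n i h s (Function.update p i P) ∪
        (σ.next u φ τ).pos n i h s (Function.update p i Q) := by
  cases n with
  | zero => exact i.elim0
  | succ n =>
    have key : ∀ P, σ.posOf u φ τ (σ.nextSI u φ τ n) i h s (Function.update p i P) =
        P.biUnion fun e => e.elim (σ.term (σ.nextSI u φ τ n) i h s p)
          fun e => σ.act u φ i h s (τ ∘ p) e.1 e.2 := fun P => by
      simp [Strategy.posOf, Strategy.term, Strategy.act, Function.comp_update]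
    exact (key _).trans (Finset.union_biUnion.trans
      (congrArg₂ _ (key P).symm (key Q).symm))

theorem Strategy.next_pos_update_empty {n : ℕ} (i : Fin n) (h : 𝓗) (s : S)
    (p : Fin n → Behav A X) : (σ.next u φ τ).pos n i h s (Function.update p i ∅) = ∅ := by
  cases n with
  | zero => exact i.elim0
  | succ n => simp [Strategy.next, Strategy.posOf]

theorem Strategy.next_pos_update_some {n : ℕ} (i : Fin n) (h : 𝓗) (s : S)
    (p : Fin n → Behav A X) (a : A) (q : X) :
    (σ.next u φ τ).pos n i h s (Function.update p i {some (a, q)}) =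
      σ.act u φ i h s (τ ∘ p) a q := by
  cases n with
  | zero => exact i.elim0
  | succ n => simp [Strategy.next, Strategy.posOf, Strategy.act, Function.comp_update]

theorem Strategy.next_pos_update_none {n : ℕ} (hn : 0 < n) (i : Fin (n + 1)) {h h' : 𝓗}
    (H : Extends h i n h') (s : S) (p : Fin (n + 1) → Behav A X) :
    (σ.next u φ τ).pos (n + 1) i h s (Function.update p i {none}) =
      (σ.next u φ τ).si n h' (σ.upd (n + 1) h s i none) fun j => p (i.succAbove j) := by
  simp [Strategy.next, Strategy.posOf, Strategy.term, hn.ne', H.extend_eq]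

theorem Strategy.next_si {n : ℕ} (h : 𝓗) (s : S) (i : Fin n) (p : Fin n → Behav A X)
    (hi : σ.sched n h s = some i) :
    (σ.next u φ τ).si n h s p = (σ.next u φ τ).pos n i h s p := by
  cases n with
  | zero => exact i.elim0
  | succ n => simp [Strategy.next, Strategy.nextSI, hi]

theorem Strategy.next_si_of_none {n : ℕ} (h : 𝓗) (s : S) (p : Fin n → Behav A X)
    (hi : σ.sched n h s = none) : (σ.next u φ τ).si n h s p = ∅ := by
  cases n with
  | zero => rfl
  | succ n => simp [Strategy.next, Strategy.nextSI, hi]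

theorem Strategy.act_of_ne {n : ℕ} (i : Fin n) {h h' : 𝓗} (H : Extends h i n h') (s : S)
    (p : Fin n → X) {a : A} (ha : a ∉ Set.range σ.cr) (q : X) :
    σ.act u φ i h s p a q = {some (σ.trace a,
      u.si n h' (σ.upd n h s i (some a)) (Function.update p i q))} := by
  have hd : ¬∃ d, σ.cr d = a := ha
  rw [Strategy.act, dif_neg hd, H.extend_eq]
  rfl

theorem Strategy.act_cr {n : ℕ} (i : Fin n) {h h' : 𝓗} (H : Extends h i (n + 1) h') (s : S)
    (p : Fin n → X) (d : D) (q : X) :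
    σ.act u φ i h s p (σ.cr d) q = {some (σ.crBar d,
      u.si (n + 1) h' (σ.upd n h s i (some (σ.cr d)))
        (Fin.snoc (α := fun _ => X) (Function.update p i q) (φ d)))} := by
  have hd : ∃ d', σ.cr d' = σ.cr d := ⟨d, rfl⟩
  rw [Strategy.act, dif_pos hd, H.extend_eq, σ.cr_injective hd.choose_spec]
  rfl

end

/-! ### The approximating models -/

section

variable {A : Type u} {γ : CommFun A} {𝓗 : Set (List (ℕ+ × ℕ+))} {S : Type v} {D : Type w}

/-- A stage of the construction of models of strategic interleaving: a model of the axioms of ACP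
with strategic interleaving operators, onto which the one-step behaviours with derivatives in it
project homomorphically by `trunc`. The process created for `d` is the value of the closed term
`σ.crea d` in the stage. -/
structure Stage (σ : Strategy γ 𝓗 S D) where
  carrier : Type u
  proc : ProcOps A carrier
  inter : InterleavingOps 𝓗 S carrier
  trunc : Behav A carrier → carrier
  isACP : proc.IsACP γ
  trunc_proc : (proc.next γ trunc).IsHom proc trunc
  trunc_inter : (σ.next inter (fun d => siEval proc inter Empty.elim (σ.crea d)) trunc).IsHom
    inter trunc

variable {σ : Strategy γ 𝓗 S D}

/-- The stage of the one-step behaviours with derivatives in the stage `P`. -/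
noncomputable def Stage.next (P : Stage σ) : Stage σ where
  carrier := Behav A P.carrier
  proc := P.proc.next γ P.trunc
  inter := σ.next P.inter (fun d => siEval P.proc P.inter Empty.elim (σ.crea d)) P.trunc
  trunc := Behav.map P.trunc
  isACP := P.isACP.next P.trunc_proc
  trunc_proc := P.trunc_proc.next fun _ => rfl
  trunc_inter := Strategy.next_isHom P.trunc_inter
    (fun d => (siEval_hom Empty.elim P.trunc_proc P.trunc_inter (σ.crea d)).trans
      (congrArg (siEval _ _ · _) (funext fun e => e.elim)))
    fun _ => rfl

variable (σ) in
/-- The stage with a single element, which identifies all processes. -/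
def Stage.trivial : Stage σ where
  carrier := PUnit
  proc := ⟨fun _ => ⟨⟩, ⟨⟩, fun _ _ => ⟨⟩, fun _ _ => ⟨⟩, fun _ _ => ⟨⟩, fun _ _ => ⟨⟩,
    fun _ _ => ⟨⟩, fun _ _ => ⟨⟩⟩
  inter := ⟨fun _ _ _ _ => ⟨⟩, fun _ _ _ _ _ => ⟨⟩⟩
  trunc _ := ⟨⟩
  isACP := by constructor <;> intros <;> rfl
  trunc_proc := by constructor <;> intros <;> rfl
  trunc_inter := by constructor <;> intros <;> rfl

variable (σ) in
/-- The model of the processes up to depth `k`. -/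
noncomputable def Stage.depth : ℕ → Stage σ
  | 0 => Stage.trivial σ
  | k + 1 => (Stage.depth k).next

theorem Stage.next_siPrefix (P : Stage σ) (a : A) (p : P.next.carrier) :
    P.next.proc.seq (P.next.proc.cst (some a)) p = ({some (a, P.trunc p)} : Behav A P.carrier) :=
  ProcOps.next_cst_seq P.isACP (some a) p

open Classical in
/-- All axioms are valid in a model of one-step behaviours. -/
theorem Stage.next_satisfies (P : Stage σ) {s t : (siLang A 𝓗 S).Term ℕ} (h : SIAxiom σ s t)
    (v : ℕ → P.next.carrier) :
    siEval P.next.proc P.next.inter v s = siEval P.next.proc P.next.inter v t := by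
  have hv : ∀ n (i : Fin n),
      Function.update (fun j : Fin n => v j) i (v i) = fun j : Fin n => v j :=
    fun n i => Function.update_eq_self i fun j : Fin n => v j
  -- the common left-hand side of the axioms for an action at the active position
  have hpre : ∀ {n : ℕ} (i : Fin n) (h : 𝓗) (s : S) (a : A),
      siEval P.next.proc P.next.inter v
        (pos i h s (Function.update (xs n) i (siPrefix a (xs n i)))) =
      σ.act P.inter (fun d => siEval P.proc P.inter Empty.elim (σ.crea d)) i h s
        (P.trunc ∘ fun j : Fin _ => v j) a (P.trunc (v i)) := fun i h s a => by
    rw [siEval_pos, siEval_update, siEval_siPrefix, P.next_siPrefix]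
    exact Strategy.next_pos_update_some i h s _ a _
  have hv' : ∀ n (i : Fin n), Function.update (P.trunc ∘ fun j : Fin n => v j) i (P.trunc (v i)) =
      P.trunc ∘ fun j : Fin n => v j := fun n i =>
    Function.update_eq_self i (P.trunc ∘ fun j : Fin n => v j)
  cases h with
  | acp h => rw [siEval_incl, siEval_incl, P.next.isACP.eval_eq h]
  | SI0 hn h s hs =>
    rw [siEval_si, siEval_incl, ProcOps.eval_cst]
    exact Strategy.next_si_of_none h s _ hs
  | SI1 hn h s i hs =>
    rw [siEval_si, siEval_pos]
    exact Strategy.next_si h s i _ hs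
  | SI2 i h s =>
    rw [siEval_pos, siEval_update, siEval_incl, ProcOps.eval_cst]
    exact Strategy.next_pos_update_empty i h s _
  | SI3T i h s =>
    simp only [siEval_pos, siEval_incl, ProcOps.eval_eps]
    exact Finset.singleton_biUnion
  | SI4T hn i h h' s H =>
    rw [siEval_pos, siEval_update, siEval_incl, ProcOps.eval_eps, siEval_si]
    exact Strategy.next_pos_update_none hn i H s _
  | SI5Ta i h h' s a H ha _ hC =>
    rw [hpre, Strategy.act_of_ne i H s _ ha, siEval_siPrefix, P.next_siPrefix, hv', siEval_si,
      Strategy.trace, dif_neg hC]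
    exact congrArg (fun q => ({some (a, q)} : Behav A P.carrier)) (P.trunc_inter.si ..).symm
  | SI5Tb i h h' s a H =>
    have ha : a.1 ∉ Set.range σ.cr := by
      rintro ⟨d, hd⟩
      exact σ.cr_notMem d (Or.inl (hd ▸ a.2))
    rw [hpre, Strategy.act_of_ne i H s _ ha, siEval_siPrefix, P.next_siPrefix, hv', siEval_si,
      Strategy.trace, dif_pos a.2]
    exact congrArg (fun q => ({some (σ.bar a, q)} : Behav A P.carrier)) (P.trunc_inter.si ..).symm
  | SI7 i h h' s d H =>
    -- The created process is interpreted in `P` on the left and in `P.next` on the right; the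
    -- projection maps the latter value to the former.
    rw [hpre, Strategy.act_cr i H s, siEval_siPrefix, P.next_siPrefix, hv', siEval_si, siEval_snoc,
      siEval_ofClosed]
    refine congrArg (fun q => ({some (σ.crBar d, q)} : Behav A P.carrier)) ?_
    refine ((P.trunc_inter.si ..).trans ?_).symm
    refine (congrArg (P.inter.si _ _ _) (Fin.comp_snoc (α := P.next.carrier) P.trunc _ _)).trans ?_
    exact congrArg (fun q => P.inter.si _ _ _ (Fin.snoc (α := fun _ => P.carrier) _ q))
      ((siEval_hom Empty.elim P.trunc_proc P.trunc_inter (σ.crea d)).trans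
        (congrArg (siEval _ _ · _) (funext fun e => e.elim)))
  | SI8 i h s =>
    rw [siEval_pos, siEval_update, siEval_siAlt, siEval_siAlt, siEval_pos, siEval_pos,
      siEval_update]
    refine (Strategy.next_pos_update_union i h s _ _ _).trans (congrArg₂ _ ?_ rfl)
    exact congrArg (P.next.inter.pos _ i h s) (hv _ i)

/-- Closed terms of ACP that are provably equal with the axioms of strategic interleaving have the
same value in every model of one-step behaviours. -/
theorem Stage.eval_eq_of_derivable (P : Stage σ) {t t' : (acpLang A).Term Empty}
    (h : Derivable (SIAxiom σ) (ofClosed (incl 𝓗 S t)) (ofClosed (incl 𝓗 S t'))) :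
    P.next.proc.eval Empty.elim t = P.next.proc.eval Empty.elim t' := by
  let := P.next.proc.toStructure
  let := P.next.inter.toStructure
  have := h.realize_eq (fun s t h v => P.next_satisfies h v) fun _ => P.next.proc.eps
  rwa [← siEval_incl P.next.proc P.next.inter, ← siEval_incl P.next.proc P.next.inter,
    ← siEval_ofClosed _ _ (fun _ => P.next.proc.eps),
    ← siEval_ofClosed _ _ (fun _ => P.next.proc.eps)]

end

/-! ### The algebra of terms modulo derivability -/

section

variable {A : Type u} (γ : CommFun A)

/-- Derivability from the axioms of ACP, as an equivalence relation. -/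
def acpSetoid : Setoid ((acpLang A).Term ℕ) where
  r := Derivable (ACPAxiom γ)
  iseqv := ⟨.refl, .symm, .trans⟩

/-- The terms of ACP modulo derivability. -/
def Proc : Type u := Quotient (acpSetoid γ)

variable {γ}

/-- The class of a term. -/
def Proc.mk (t : (acpLang A).Term ℕ) : Proc γ := Quotient.mk (acpSetoid γ) t

theorem Proc.mk_eq {s t : (acpLang A).Term ℕ} :
    Proc.mk (γ := γ) s = Proc.mk t ↔ Derivable (ACPAxiom γ) s t := Quotient.eq

theorem Derivable.congr₂ {Ax : (acpLang A).Term ℕ → (acpLang A).Term ℕ → Prop} (f : ACPOp A 2)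
    {s s' t t' : (acpLang A).Term ℕ} (hs : Derivable Ax s s') (ht : Derivable Ax t t') :
    Derivable Ax (Term.func (L := acpLang A) f ![s, t]) (Term.func (L := acpLang A) f ![s', t']) :=
  .congr (L := acpLang A) f fun i => by
    refine Fin.cases hs (fun i => ?_) i
    rw [Subsingleton.elim i 0]
    exact ht

/-- A binary operator on the classes of terms. -/
def Proc.op₂ (f : ACPOp A 2) : Proc γ → Proc γ → Proc γ :=
  Quotient.map₂ (fun s t => Term.func (L := acpLang A) f ![s, t])
    fun _ _ hs _ _ ht => Derivable.congr₂ f hs ht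

variable (γ) in
/-- The operations on the classes of terms. -/
def Proc.ops : ProcOps A (Proc γ) where
  cst a := Proc.mk (cst a)
  eps := Proc.mk eps
  alt := Proc.op₂ .alt
  seq := Proc.op₂ .seq
  par := Proc.op₂ .par
  lmerge := Proc.op₂ .leftMerge
  cmerge := Proc.op₂ .commMerge
  encap H := Quotient.map (encap H) fun _ _ h =>
    .congr (L := acpLang A) (ACPOp.encap H) fun i => by rw [Subsingleton.elim i 0]; exact h

/-- The value of a term in the algebra of classes is the class of a substitution instance. -/
theorem Proc.eval_mk (ρ : ℕ → (acpLang A).Term ℕ) (t : (acpLang A).Term ℕ) :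
    (Proc.ops γ).eval (fun i => Proc.mk (ρ i)) t = Proc.mk (t.subst ρ) := by
  induction t with
  | var => rfl
  | func f ts ih =>
    have h₂ : ∀ (g : ACPOp A 2) (us : Fin 2 → (acpLang A).Term ℕ),
        Proc.op₂ (γ := γ) g (Proc.mk (us 0)) (Proc.mk (us 1)) =
          Proc.mk (Term.func (L := acpLang A) g us) := fun g us =>
      congrArg (fun us => Proc.mk (Term.func (L := acpLang A) g us))
        (funext fun i => by fin_cases i <;> rfl)
    cases f
    case delta =>
      exact congrArg (fun us => Proc.mk (Term.func (L := acpLang A) .delta us))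
        (Subsingleton.elim _ _)
    case eps =>
      exact congrArg (fun us => Proc.mk (Term.func (L := acpLang A) .eps us))
        (Subsingleton.elim _ _)
    case act a =>
      exact congrArg (fun us => Proc.mk (Term.func (L := acpLang A) (.act a) us))
        (Subsingleton.elim _ _)
    case encap H =>
      refine (congrArg ((Proc.ops γ).encap H) (ih 0)).trans ?_
      exact congrArg (fun us => Proc.mk (Term.func (L := acpLang A) (.encap H) us))
        (funext fun i => by fin_cases i; rfl)
    all_goals exact (congrArg₂ (Proc.op₂ _) (ih 0) (ih 1)).trans (h₂ _ fun i => (ts i).subst ρ)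

theorem subst_var {L : FirstOrder.Language.{u, v}} {V : Type w} (t : L.Term V) :
    t.subst Term.var = t := by
  induction t with
  | var => rfl
  | func f ts ih => exact congrArg (Term.func f) (funext ih)

theorem Proc.eval_ofClosed (t : (acpLang A).Term Empty) :
    (Proc.ops γ).eval Empty.elim t = Proc.mk (ofClosed t) := by
  rw [← StrategicInterleaving.eval_ofClosed (Proc.ops γ) (fun i => Proc.mk (Term.var i)),
    Proc.eval_mk]
  exact congrArg Proc.mk (subst_var _)

/-- A valuation in the algebra of classes lifts to a substitution, so the axioms hold in it. -/
theorem Proc.isACP : (Proc.ops γ).IsACP γ := by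
  have key : ∀ {s t : (acpLang A).Term ℕ}, ACPAxiom γ s t → ∀ v : ℕ → Proc γ,
      (Proc.ops γ).eval v s = (Proc.ops γ).eval v t := by
    intro s t h v
    choose ρ hρ using fun i => Quotient.exists_rep (v i)
    obtain rfl : (fun i => Proc.mk (ρ i)) = v := funext hρ
    rw [Proc.eval_mk, Proc.eval_mk]
    exact Proc.mk_eq.2 (.subst ρ (.ax h))
  let v (p q r : Proc γ) : ℕ → Proc γ := fun i => if i = 0 then p else if i = 1 then q else r
  have key₃ : ∀ {s t : (acpLang A).Term ℕ}, ACPAxiom γ s t → ∀ p q r : Proc γ,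
      (Proc.ops γ).eval (v p q r) s = (Proc.ops γ).eval (v p q r) t := fun h p q r => key h _
  constructor
  case alt_comm => exact fun p q => key₃ .A1 p q p
  case alt_assoc => exact fun p q r => key₃ .A2 p q r
  case alt_self => exact fun p => key₃ .A3 p p p
  case alt_seq => exact fun p q r => key₃ .A4 p q r
  case seq_assoc => exact fun p q r => key₃ .A5 p q r
  case alt_delta => exact fun p => key₃ .A6 p p p
  case delta_seq => exact fun p => key₃ .A7 p p p
  case seq_eps => exact fun p => key₃ .A8 p p p
  case eps_seq => exact fun p => key₃ .A9 p p p
  case encap_eps => exact fun H => key (.D0 H) fun _ => (Proc.ops γ).eps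
  case encap_cst => exact fun H a ha => by simpa using key (.D1 H a ha) fun _ => (Proc.ops γ).eps
  case encap_cst_of_mem => exact fun H a ha => key (.D2 H a ha) fun _ => (Proc.ops γ).eps
  case encap_alt => exact fun H p q => key₃ (.D3 H) p q p
  case encap_seq => exact fun H p q => key₃ (.D4 H) p q p
  case par_eq => exact fun p q => key₃ .CM1T p q p
  case eps_lmerge => exact fun p => key₃ .CM2T p p p
  case cst_seq_lmerge => exact fun a p q => by simpa [x, y, v] using key₃ (.CM3 a) p q p
  case alt_lmerge => exact fun p q r => key₃ .CM4 p q r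
  case eps_cmerge => exact fun p => key₃ .CM5T p p p
  case cmerge_eps => exact fun p => key₃ .CM6T p p p
  case cst_seq_cmerge_cst_seq =>
    intro a b p q
    simpa [x, y, v] using key₃ (.CM7 a b) p q p
  case alt_cmerge => exact fun p q r => key₃ .CM8 p q r
  case cmerge_alt => exact fun p q r => key₃ .CM9 p q r
  case cst_cmerge_cst =>
    intro a b
    simpa using key (.CM10 a b) fun _ => (Proc.ops γ).eps
  case delta_cmerge => exact fun p => key₃ .CM11 p p p
  case cmerge_delta => exact fun p => key₃ .CM12 p p p

end

/-! ### Elimination of the operators other than choice and action prefix -/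

section

variable {A : Type u} {γ : CommFun A}

/-- The elements of an algebra that are built from inaction and the empty process by action
prefix and alternative composition only. -/
inductive ProcOps.IsBasic {X : Type w} (o : ProcOps A X) : X → Prop
  | delta : IsBasic o (o.cst none)
  | eps : IsBasic o o.eps
  | step (a : A) {p : X} : IsBasic o p → IsBasic o (o.seq (o.cst (some a)) p)
  | alt {p q : X} : IsBasic o p → IsBasic o q → IsBasic o (o.alt p q)

variable {X : Type w} {o : ProcOps A X}

theorem ProcOps.IsBasic.cst_seq (ho : o.IsACP γ) (a : Option A) {p : X} (hp : o.IsBasic p) :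
    o.IsBasic (o.seq (o.cst a) p) := by
  cases a with
  | none => rw [ho.delta_seq]; exact .delta
  | some a => exact .step a hp

theorem ProcOps.IsBasic.cst (ho : o.IsACP γ) (a : Option A) : o.IsBasic (o.cst a) := by
  rw [← ho.seq_eps (o.cst a)]
  exact .cst_seq ho a .eps

theorem ProcOps.IsBasic.seq (ho : o.IsACP γ) {p q : X} (hp : o.IsBasic p) (hq : o.IsBasic q) :
    o.IsBasic (o.seq p q) := by
  induction hp with
  | delta => rw [ho.delta_seq]; exact .delta
  | eps => rwa [ho.eps_seq]
  | step a _ ih => rw [ho.seq_assoc]; exact .step a ih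
  | alt _ _ ih₁ ih₂ => rw [ho.alt_seq]; exact .alt ih₁ ih₂

theorem ProcOps.IsBasic.encap (ho : o.IsACP γ) (H : Set A) {p : X} (hp : o.IsBasic p) :
    o.IsBasic (o.encap H p) := by
  induction hp with
  | delta => rw [ho.encap_cst H none (by simp)]; exact .delta
  | eps => rw [ho.encap_eps]; exact .eps
  | step a _ ih =>
    rw [ho.encap_seq]
    by_cases ha : a ∈ H
    · rw [ho.encap_cst_of_mem H a ha, ho.delta_seq]
      exact .delta
    · rw [ho.encap_cst H (some a) fun b hb h => ha (Option.some.inj h ▸ hb)]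
      exact .step a ih
  | alt _ _ ih₁ ih₂ => rw [ho.encap_alt]; exact .alt ih₁ ih₂

theorem ProcOps.IsACP.delta_lmerge (ho : o.IsACP γ) (p : X) :
    o.lmerge (o.cst none) p = o.cst none := by
  rw [← ho.delta_seq o.eps, ho.cst_seq_lmerge, ho.delta_seq, ho.delta_seq]

/-- The parallel compositions with `p` in either order, given the left merges out of `p` and the
communication merges; the left merges into `p` are treated by induction on the other argument. -/
theorem ProcOps.IsBasic.par_of_merges (ho : o.IsACP γ) {p : X} (hp : o.IsBasic p)
    (h : ∀ q, o.IsBasic q →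
      o.IsBasic (o.lmerge p q) ∧ o.IsBasic (o.cmerge p q) ∧ o.IsBasic (o.cmerge q p))
    {q : X} (hq : o.IsBasic q) : o.IsBasic (o.par p q) ∧ o.IsBasic (o.par q p) := by
  have hpar : ∀ {p q}, o.IsBasic p → o.IsBasic q → o.IsBasic (o.lmerge p q) →
      o.IsBasic (o.lmerge q p) → o.IsBasic (o.cmerge p q) → o.IsBasic (o.par p q) := by
    intro p q hp hq h₁ h₂ h₃
    rw [ho.par_eq]
    exact .alt (.alt (.alt h₁ h₂) h₃) (.seq ho (.encap ho _ hp) (.encap ho _ hq))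
  have hl : o.IsBasic (o.lmerge q p) := by
    induction hq with
    | delta => rw [ho.delta_lmerge]; exact .delta
    | eps => rw [ho.eps_lmerge]; exact .delta
    | step b hq ih =>
      rw [ho.cst_seq_lmerge]
      exact .step b (hpar hq hp ih (h _ hq).1 (h _ hq).2.2)
    | alt _ _ ih₁ ih₂ => rw [ho.alt_lmerge]; exact .alt ih₁ ih₂
  exact ⟨hpar hp hq (h q hq).1 hl (h q hq).2.1, hpar hq hp hl (h q hq).1 (h q hq).2.2⟩

theorem ProcOps.IsBasic.merges (ho : o.IsACP γ) {p : X} (hp : o.IsBasic p) :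
    ∀ q, o.IsBasic q →
      o.IsBasic (o.lmerge p q) ∧ o.IsBasic (o.cmerge p q) ∧ o.IsBasic (o.cmerge q p) := by
  induction hp with
  | delta =>
    intro q _
    rw [ho.delta_lmerge, ho.delta_cmerge, ho.cmerge_delta]
    exact ⟨.delta, .delta, .delta⟩
  | eps =>
    intro q _
    rw [ho.eps_lmerge, ho.eps_cmerge, ho.cmerge_eps]
    exact ⟨.delta, .delta, .delta⟩
  | step a hp ih =>
    intro q hq
    have hpar := fun {q} (hq : o.IsBasic q) => par_of_merges ho hp ih hq
    refine ⟨?_, ?_⟩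
    · rw [ho.cst_seq_lmerge]
      exact .step a (hpar hq).1
    · induction hq with
      | delta => rw [ho.cmerge_delta, ho.delta_cmerge]; exact ⟨.delta, .delta⟩
      | eps => rw [ho.cmerge_eps, ho.eps_cmerge]; exact ⟨.delta, .delta⟩
      | step b hq _ =>
        rw [ho.cst_seq_cmerge_cst_seq, ho.cst_seq_cmerge_cst_seq]
        exact ⟨.cst_seq ho _ (hpar hq).1, .cst_seq ho _ (hpar hq).2⟩
      | alt _ _ ih₁ ih₂ =>
        rw [ho.cmerge_alt, ho.alt_cmerge]
        exact ⟨.alt ih₁.1 ih₂.1, .alt ih₁.2 ih₂.2⟩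
  | alt _ _ ih₁ ih₂ =>
    intro q hq
    rw [ho.alt_lmerge, ho.alt_cmerge, ho.cmerge_alt]
    obtain ⟨h₁, h₂, h₃⟩ := ih₁ q hq
    obtain ⟨h₁', h₂', h₃'⟩ := ih₂ q hq
    exact ⟨.alt h₁ h₁', .alt h₂ h₂', .alt h₃ h₃'⟩

/-- Every closed term denotes a basic element. -/
theorem ProcOps.IsACP.isBasic_eval (ho : o.IsACP γ) (t : (acpLang A).Term Empty) :
    o.IsBasic (o.eval Empty.elim t) := by
  induction t with
  | var e => exact e.elim
  | func f ts ih =>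
    cases f
    case delta => exact .delta
    case eps => exact .eps
    case act a => exact .cst ho (some a)
    case alt => exact .alt (ih 0) (ih 1)
    case seq => exact .seq ho (ih 0) (ih 1)
    case par => exact (ProcOps.IsBasic.par_of_merges ho (ih 0) (ProcOps.IsBasic.merges ho (ih 0))
      (ih 1)).1
    case leftMerge => exact (ProcOps.IsBasic.merges ho (ih 0) _ (ih 1)).1
    case commMerge => exact (ProcOps.IsBasic.merges ho (ih 0) _ (ih 1)).2.1
    case encap H => exact .encap ho H (ih 0)

end

/-! ### Recovering a closed term from its value -/

section

variable {A : Type u} {γ : CommFun A} {𝓗 : Set (List (ℕ+ × ℕ+))} {S : Type v} {D : Type w}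

/-- Alternative composition as the supremum of a semilattice. -/
instance : SemilatticeSup (Proc γ) :=
  letI : Max (Proc γ) := ⟨(Proc.ops γ).alt⟩
  SemilatticeSup.mk' Proc.isACP.alt_comm Proc.isACP.alt_assoc Proc.isACP.alt_self

/-- Inaction is the least element. -/
instance : OrderBot (Proc γ) where
  bot := (Proc.ops γ).cst none
  bot_le p := sup_eq_right.1 <| (Proc.isACP.alt_comm _ _).trans (Proc.isACP.alt_delta p)

/-- The value of a term in a model, as a function of the class of the term. Variables have the empty
process as their value, which is immaterial for closed terms. -/
def Proc.value {X : Type w} {o : ProcOps A X} (ho : o.IsACP γ) : Proc γ → X :=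
  Quotient.lift (o.eval fun _ => o.eps) fun _ _ h =>
    letI := o.toStructure
    h.realize_eq (fun _ _ h v => ho.eval_eq h v) _

theorem Proc.value_mk {X : Type w} {o : ProcOps A X} (ho : o.IsACP γ) (t : (acpLang A).Term ℕ) :
    Proc.value ho (Proc.mk t) = o.eval (fun _ => o.eps) t := rfl

theorem Proc.value_alt {X : Type w} {o : ProcOps A X} (ho : o.IsACP γ) (p q : Proc γ) :
    Proc.value ho ((Proc.ops γ).alt p q) = o.alt (Proc.value ho p) (Proc.value ho q) :=
  Quotient.inductionOn₂ p q fun _ _ => rfl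

theorem Proc.value_seq {X : Type w} {o : ProcOps A X} (ho : o.IsACP γ) (p q : Proc γ) :
    Proc.value ho ((Proc.ops γ).seq p q) = o.seq (Proc.value ho p) (Proc.value ho q) :=
  Quotient.inductionOn₂ p q fun _ _ => rfl

/-- The class of terms described by an element of a model of bounded depth: a behaviour is the
sum of its capabilities. -/
noncomputable def Stage.readback (σ : Strategy γ 𝓗 S D) :
    (k : ℕ) → (Stage.depth σ k).carrier → Proc γ
  | 0 => fun _ => ⊥
  | k + 1 => fun P => Finset.sup (α := Proc γ) (show Behav A (Stage.depth σ k).carrier from P)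
      fun e => e.elim (Proc.ops γ).eps fun e =>
        (Proc.ops γ).seq ((Proc.ops γ).cst (some e.1)) (Stage.readback σ k e.2)

/-- The projection maps the value of a term to its value in the preceding model. -/
theorem Stage.trunc_value {σ : Strategy γ 𝓗 S D} (P : Stage σ) (p : Proc γ) :
    P.trunc (Proc.value P.next.isACP p) = Proc.value P.isACP p := by
  refine Quotient.inductionOn p fun t => ?_
  have h := siEval_hom (fun _ : ℕ => P.next.proc.eps) P.trunc_proc P.trunc_inter (incl 𝓗 S t)
  refine (congrArg P.trunc (siEval_incl P.next.proc P.next.inter _ t)).symm.trans (h.trans ?_)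
  rw [siEval_incl]
  exact congrArg (P.proc.eval · t) (funext fun _ => P.trunc_proc.eps)

open Classical in
/-- A basic element is recovered from its value in the model of every sufficient depth. -/
theorem Stage.exists_readback_value (σ : Strategy γ 𝓗 S D) {p : Proc γ}
    (hp : (Proc.ops γ).IsBasic p) :
    ∃ m, ∀ k, m ≤ k → Stage.readback σ k (Proc.value (Stage.depth σ k).isACP p) = p := by
  -- Depths are shifted by one, since only positive depths are given by one-step behaviours.
  suffices h : ∃ m, ∀ k, m ≤ k →
      Stage.readback σ (k + 1) (Proc.value (Stage.depth σ k).next.isACP p) = p by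
    obtain ⟨m, hm⟩ := h
    refine ⟨m + 1, fun k hk => ?_⟩
    obtain ⟨k, rfl⟩ := Nat.exists_eq_add_of_lt hk
    exact hm _ (by omega)
  induction hp with
  | delta => exact ⟨0, fun _ _ => rfl⟩
  | eps => exact ⟨0, fun _ _ => Finset.sup_singleton⟩
  | @step a p _ ih =>
    obtain ⟨m, hm⟩ := ih
    refine ⟨m + 1, fun k hk => ?_⟩
    obtain ⟨k, rfl⟩ := Nat.exists_eq_add_of_lt hk
    refine (congrArg (Stage.readback σ _) <|
      Proc.value_seq (Stage.depth σ _).next.isACP _ _).trans ?_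
    refine (congrArg (Stage.readback σ _) ((Stage.depth σ _).next_siPrefix a _)).trans ?_
    refine Finset.sup_singleton.trans ?_
    exact congrArg ((Proc.ops γ).seq _) <|
      (congrArg (Stage.readback σ _) (Stage.trunc_value _ p)).trans (hm _ (by omega))
  | alt _ _ ih₁ ih₂ =>
    obtain ⟨m₁, h₁⟩ := ih₁
    obtain ⟨m₂, h₂⟩ := ih₂
    refine ⟨max m₁ m₂, fun k hk => ?_⟩
    refine (congrArg (Stage.readback σ _) <|
      Proc.value_alt (Stage.depth σ k).next.isACP _ _).trans ?_
    exact Finset.sup_union.trans (congrArg₂ _ (h₁ k (by omega)) (h₂ k (by omega)))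

end

end StrategicInterleaving

open StrategicInterleaving in
theorem theorem3 {A : Type u} (γ : StrategicInterleaving.CommFun A)
    (𝓗 : Set (List (ℕ+ × ℕ+))) (h𝓗 : StrategicInterleaving.Hist ⊆ 𝓗)
    {S : Type v} {D : Type w} [Countable D] (σ : StrategicInterleaving.Strategy γ 𝓗 S D)
    (t t' : (StrategicInterleaving.acpLang A).Term Empty)
    (h : StrategicInterleaving.Derivable (StrategicInterleaving.SIAxiom σ)
      (StrategicInterleaving.ofClosed (StrategicInterleaving.incl 𝓗 S t))
      (StrategicInterleaving.ofClosed (StrategicInterleaving.incl 𝓗 S t'))) :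
    StrategicInterleaving.Derivable (StrategicInterleaving.ACPAxiom γ)
      (StrategicInterleaving.ofClosed t) (StrategicInterleaving.ofClosed t') := by
  have hb : ∀ t : (acpLang A).Term Empty, (Proc.ops γ).IsBasic (Proc.mk (ofClosed t)) := fun t =>
    Proc.eval_ofClosed (γ := γ) t ▸ Proc.isACP.isBasic_eval t
  obtain ⟨m, hm⟩ := Stage.exists_readback_value σ (hb t)
  obtain ⟨m', hm'⟩ := Stage.exists_readback_value σ (hb t')
  let k := max m m' + 1
  have hv : ∀ t : (acpLang A).Term Empty, Proc.value (Stage.depth σ k).isACP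
      (Proc.mk (ofClosed t)) = (Stage.depth σ k).proc.eval Empty.elim t := fun t =>
    (Proc.value_mk _ _).trans (eval_ofClosed _ _ _)
  refine Proc.mk_eq.1 ?_
  rw [← hm k (by omega), ← hm' k (by omega), hv, hv]
  exact congrArg _ ((Stage.depth σ (max m m')).eval_eq_of_derivable h)
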